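/- All rings are nontrivial, unital and not necessarily commutative. A ring $R$ is \emph{fadelian} if for every $x \in R$ and every nonzero $a \in R$ there exist $b, c \in R$ such that $x = ab + ca$. A ring without zero divisors is \emph{right} (resp. \emph{left}) \emph{Ore} if any two of its nonzero right (resp. left) ideals have nonzero intersection. For a ring $R$, let $R((X))$ be the ring of formal Laurent series with coefficients in $R$ in an indeterminate $X$ that commutes with the elements of $R$. There exists a fadelian ring (without zero divisors) which is neither right nor left Ore. More precisely, there exists a countable fadelian ring $R$ which is neither left nor right Noetherian and such that $R((X))$ is a fadelian ring without zero divisors which is neither right nor left Ore. -/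

import Mathlib

/-- A ring is fadelian if it is nontrivial and, for any `x` and any nonzero `a`, there are `b`, `c`
with `x = a * b + c * a`. -/
structure IsFadelian (R : Type*) [Ring R] : Prop where
  nontrivial : Nontrivial R
  exists_eq : ∀ x a : R, a ≠ 0 → ∃ b c : R, x = a * b + c * a

/-- The left Ore condition: any two nonzero left ideals have a nonzero intersection.
(A notion for rings without zero divisors.) -/
def IsLeftOre (R : Type*) [Ring R] : Prop :=
  ∀ I J : Submodule R R, I ≠ ⊥ → J ≠ ⊥ → I ⊓ J ≠ ⊥

/-- The right Ore condition: any two nonzero right ideals have a nonzero intersection.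
(A notion for rings without zero divisors.) Right ideals of `R` are the submodules of `R` for the
action of the opposite ring by right multiplication. -/
def IsRightOre (R : Type*) [Ring R] : Prop :=
  ∀ I J : Submodule Rᵐᵒᵖ R, I ≠ ⊥ → J ≠ ⊥ → I ⊓ J ≠ ⊥

/-- Left Noetherian: left ideals satisfy the ascending chain condition. -/
def IsLeftNoetherian (R : Type*) [Ring R] : Prop :=
  IsNoetherian R R

/-- Right Noetherian: right ideals satisfy the ascending chain condition. -/
def IsRightNoetherian (R : Type*) [Ring R] : Prop :=
  IsNoetherian Rᵐᵒᵖ R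

/-!
The ring is obtained in three steps from a single fadelian domain `T` that is not a division ring.

* `T` is the skew Laurent polynomial ring `K[F, F⁻¹]` over an algebraically closed field `K` of
  characteristic `p`, with `F` acting as the Frobenius automorphism; it is realised as a ring of
  additive maps `K → K` (`frobeniusPolynomialRing`). Its nonzero elements are polynomial maps up to
  powers of `F`, hence surjective because `K` is algebraically closed, so `T` is a domain. Up to a
  unit, a nonzero element is a separable additive polynomial map `s`, with finite kernel `V`. To
  solve `x = s * b + c * s`, lift `x` restricted to `V` through the surjection `s` to an additive
  map on `V`, and interpolate it by an additive polynomial `b`: the Lagrange interpolant is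
  automatically additive. Then `x - s * b` vanishes on `V`, so it factors as `c * s`
  (`frobeniusPolynomialRing.isFadelian`). The element `F - 1` is a nonunit.

* Being a fadelian domain passes to ultrapowers. In an ultrapower over `ℕ`, the classes of
  `k ↦ t ^ (k - n)`, for a nonzero nonunit `t` of `T`, generate strictly increasing chains of left
  and of right ideals (`exists_strictChain_germ`). Closing these classes under the ring operations
  and under a choice of solutions gives a countable fadelian domain `R` with such chains, so that
  `R` is neither left nor right Noetherian.

* The equation `x = a * b + c * a` in `R((X))` is solved coefficient by coefficient from the leading
  coefficient of `a`. For the failure of the right Ore condition, let `d 0, d 1, …` be a strict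
  chain and enumerate `R`. Since `1 = h * b + c * h`, some right multiple `d (n + 1) * w n` is not
  sent into `d 0 R + ⋯ + d n R` by right multiplication by the `n`-th element `h`, if `h ≠ 0`.
  Then no nonzero right multiple of `∑ d (n + 1) w n X ^ n` has all its coefficients in `d 0 R`.
-/

/-! ### Skew Laurent polynomials in the Frobenius automorphism -/

open Polynomial in
/-- The ring of additive endomorphisms `f` of a field `K` of characteristic `p` such that some power
`y ↦ f y ^ p ^ N` is a polynomial function. For `K` infinite and perfect, this is the skew Laurent
polynomial ring `K[F, F⁻¹]`, where `F` is the Frobenius automorphism. -/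
def frobeniusPolynomialRing (K : Type*) [Field K] (p : ℕ) [Fact p.Prime] [CharP K p] :
    Subring (AddMonoid.End K) where
  carrier := {f | ∃ (N : ℕ) (P : K[X]), ∀ y, f y ^ p ^ N = P.eval y}
  one_mem' := ⟨0, X, by simp⟩
  zero_mem' := ⟨0, 0, by simp⟩
  neg_mem' := by
    rintro f ⟨N, P, h⟩
    refine ⟨N, -P, fun y => ?_⟩
    have := map_neg (iterateFrobenius K p N) (f y)
    rw [iterateFrobenius_def, iterateFrobenius_def] at this
    change (-f y) ^ p ^ N = _
    rw [this, h, eval_neg]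
  add_mem' := by
    rintro f g ⟨N, P, h⟩ ⟨M, Q, h'⟩
    refine ⟨N + M, P ^ p ^ M + Q ^ p ^ N, fun y => ?_⟩
    change (f y + g y) ^ p ^ (N + M) = _
    rw [add_pow_char_pow, eval_add, eval_pow, eval_pow, ← h, ← h',
      ← pow_mul, ← pow_mul, ← pow_add, ← pow_add, add_comm M N]
  mul_mem' := by
    rintro f g ⟨N, P, h⟩ ⟨M, Q, h'⟩
    refine ⟨N + M, (P.map (iterateFrobenius K p M)).comp Q, fun y => ?_⟩
    change f (g y) ^ p ^ (N + M) = _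
    rw [eval_comp, ← h', ← iterateFrobenius_def p M (g y),
      eval_map_apply, ← h, iterateFrobenius_def, ← pow_mul, ← pow_add]

namespace frobeniusPolynomialRing

open Polynomial

section Additive

variable {K : Type*} [Field K]

/-- An additive polynomial has constant derivative. -/
theorem derivative_eq_C_of_additive [Infinite K] {P : K[X]}
    (hP : ∀ x y, P.eval (x + y) = P.eval x + P.eval y) :
    derivative P = C ((derivative P).eval 0) := by
  refine Polynomial.funext fun v => ?_
  have h : P.comp (X + C v) = P + C (P.eval v) :=
    Polynomial.funext fun x => by simp [hP]
  have h' := congrArg (fun Q => (derivative Q).eval 0) h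
  simpa [derivative_comp] using h'

/-- A polynomial that is invariant under translation by the roots of an additive polynomial `S`
with simple roots is a polynomial in `S`. -/
theorem exists_eq_comp_of_invariant [IsAlgClosed K] {S : K[X]}
    (hS : ∀ x y, S.eval (x + y) = S.eval x + S.eval y) (hsep : S.Separable)
    {n : ℕ} {Q : K[X]} (hn : Q.natDegree ≤ n)
    (hQ : ∀ v, S.eval v = 0 → ∀ y, Q.eval (y + v) = Q.eval y) :
    ∃ C : K[X], Q = C.comp S := by
  have : Infinite K := IsAlgClosed.instInfinite
  induction n using Nat.strong_induction_on generalizing Q with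
  | _ n ih =>
    have hS0 : S ≠ 0 := hsep.ne_zero
    have h00 : S.eval 0 = 0 := by simpa using hS 0 0
    -- all roots of `S` are simple, and they are roots of `Q - Q(0)`
    have hdvd : S ∣ Q - C (Q.eval 0) := by
      by_cases hq : Q - C (Q.eval 0) = 0
      · rw [hq]; exact dvd_zero _
      refine (IsAlgClosed.splits S).dvd_of_roots_le_roots hS0 ?_
      rw [Multiset.le_iff_subset (nodup_roots hsep)]
      intro v hv
      rw [mem_roots hS0, IsRoot.def] at hv
      have := hQ v hv 0
      rw [zero_add] at this
      rw [mem_roots hq, IsRoot.def, eval_sub, eval_C, this, sub_self]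
    obtain ⟨Q₁, hQ₁⟩ := hdvd
    have hdeg : 1 ≤ S.natDegree := by
      by_contra! h
      rw [Nat.lt_one_iff] at h
      rw [eq_C_of_natDegree_eq_zero h, eval_C] at h00
      rw [eq_C_of_natDegree_eq_zero h, h00, C_0] at hS0
      exact hS0 rfl
    by_cases h1 : Q₁ = 0
    · exact ⟨C (Q.eval 0), by simpa [h1, sub_eq_zero] using hQ₁⟩
    have hlt : Q₁.natDegree < n := by
      have := congrArg natDegree hQ₁
      rw [natDegree_sub_C, natDegree_mul hS0 h1] at this
      omega
    obtain ⟨C₁, hC₁⟩ := ih _ hlt le_rfl (Q := Q₁) fun v hv => by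
      have key : Q₁.comp (X + C v) = Q₁ := by
        refine mul_left_cancel₀ hS0 (Polynomial.funext fun y => ?_)
        have e1 := congrArg (eval (y + v)) hQ₁
        have e2 := congrArg (eval y) hQ₁
        simp only [eval_sub, eval_C, eval_mul, hS, hv, add_zero, hQ v hv] at e1 e2
        simp [← e1, ← e2]
      intro y
      simpa using congrArg (eval y) key
    refine ⟨X * C₁ + C (Q.eval 0), ?_⟩
    rw [add_comp, mul_comp, X_comp, C_comp, ← hC₁, ← hQ₁, sub_add_cancel]

/-- An additive map on a finite additive subgroup `V` of `K` is the restriction of an additive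
polynomial: its Lagrange interpolant of degree less than `|V|`. -/
theorem exists_additive_interpolation (V : AddSubgroup K) [Finite V] (g : V →+ K) :
    ∃ B : K[X], (∀ x y, B.eval (x + y) = B.eval x + B.eval y) ∧ ∀ v : V, B.eval (v : K) = g v := by
  classical
  have := Fintype.ofFinite V
  set B : K[X] := Lagrange.interpolate (Finset.univ : Finset V) (fun v => (v : K)) g with hB
  have hinj : Set.InjOn (fun v : V => (v : K)) (Finset.univ : Finset V) :=
    Subtype.val_injective.injOn
  have hBv : ∀ v : V, B.eval (v : K) = g v := fun v =>
    Lagrange.eval_interpolate_at_node _ hinj (Finset.mem_univ v)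
  have hdeg : B.degree < (Finset.univ : Finset V).card := Lagrange.degree_interpolate_lt _ hinj
  have hcard : 0 < (Finset.univ : Finset V).card := Finset.card_pos.2 ⟨0, Finset.mem_univ _⟩
  -- `B(X + y) - B(X) - B(y)` has degree less than `|V|`, so it is zero once it vanishes on `V`
  have key : ∀ y : K, (∀ v : V, B.eval (v + y) = B.eval (v : K) + B.eval y) →
      ∀ x, B.eval (x + y) = B.eval x + B.eval y := by
    intro y hy x
    have h : B.comp (X + C y) = B + C (B.eval y) := by
      refine eq_of_degrees_lt_of_eval_index_eq (Finset.univ : Finset V) hinj ?_ ?_ ?_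
      · rcases eq_or_ne B 0 with h0 | h0
        · simp [h0]
        · refine lt_of_le_of_lt degree_le_natDegree ?_
          rw [natDegree_comp, natDegree_X_add_C, mul_one, ← degree_eq_natDegree h0]
          exact hdeg
      · refine lt_of_le_of_lt (degree_add_le _ _) (max_lt hdeg ?_)
        exact lt_of_le_of_lt degree_C_le (by exact_mod_cast hcard)
      · intro v _
        simpa using hy v
    simpa using congrArg (eval x) h
  have h1 : ∀ (w : V) (x : K), B.eval (x + w) = B.eval x + B.eval (w : K) := fun w =>
    key w fun v => by
      rw [← AddSubgroup.coe_add, hBv, hBv, hBv, map_add]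
  refine ⟨B, fun x y => key y (fun v => ?_) x, hBv⟩
  rw [add_comm, h1, add_comm]

end Additive

variable {K : Type*} [Field K] {p : ℕ} [Fact p.Prime] [CharP K p]

/-- A nonzero additive polynomial is a power of Frobenius composed with a separable one. -/
theorem exists_separable_pow [IsAlgClosed K] {n : ℕ} {P : K[X]} (hn : P.natDegree ≤ n) (h0 : P ≠ 0)
    (hP : ∀ x y, P.eval (x + y) = P.eval x + P.eval y) :
    ∃ (M : ℕ) (S : K[X]), S.Separable ∧ (∀ x y, S.eval (x + y) = S.eval x + S.eval y) ∧
      ∀ y, P.eval y = S.eval y ^ p ^ M := by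
  have : Infinite K := IsAlgClosed.instInfinite
  induction n using Nat.strong_induction_on generalizing P with
  | _ n ih =>
    have hp : p.Prime := Fact.out
    have hd := derivative_eq_C_of_additive hP
    by_cases hκ : (derivative P).eval 0 = 0
    · rw [hκ, C_0] at hd
      -- a polynomial with zero derivative is a `p`-th power, as `K` is perfect
      set R : K[X] := (contract p P).map (frobeniusEquiv K p).symm.toRingHom with hR
      have hRP : R ^ p = P := by
        rw [← map_frobenius_expand, hR, ← map_expand, expand_contract p hd hp.ne_zero, map_map]
        have hid : (frobenius K p).comp (frobeniusEquiv K p).symm.toRingHom = RingHom.id K :=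
          RingHom.ext fun x => frobenius_apply_frobeniusEquiv_symm K p x
        rw [hid, Polynomial.map_id]
      have hR0 : R ≠ 0 := by
        rintro h
        rw [h, zero_pow hp.ne_zero] at hRP
        exact h0 hRP.symm
      have hPdeg : 1 ≤ P.natDegree := by
        by_contra! h
        rw [Nat.lt_one_iff] at h
        have h00 : P.eval 0 = 0 := by simpa using hP 0 0
        rw [eq_C_of_natDegree_eq_zero h, eval_C] at h00
        rw [eq_C_of_natDegree_eq_zero h, h00, C_0] at h0
        exact h0 rfl
      have hdeg : R.natDegree < n := by
        have h := congrArg natDegree hRP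
        rw [natDegree_pow] at h
        have := hp.two_le
        nlinarith
      obtain ⟨M, S, hS, hSa, hRS⟩ := ih _ hdeg le_rfl hR0 fun x y => by
        apply frobenius_inj K p
        simp only [map_add, frobenius_def, ← eval_pow, hRP, hP]
      exact ⟨M + 1, S, hS, hSa, fun y => by rw [← hRP, eval_pow, hRS, ← pow_mul, pow_succ]⟩
    · refine ⟨0, P, ?_, hP, by simp⟩
      rw [Polynomial.Separable, hd]
      exact ⟨0, C ((derivative P).eval 0)⁻¹, by
        rw [zero_mul, zero_add, ← C_mul, inv_mul_cancel₀ hκ, C_1]⟩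

theorem mem_iff {f : AddMonoid.End K} : f ∈ frobeniusPolynomialRing K p ↔
    ∃ (N : ℕ) (P : K[X]), ∀ y, f y ^ p ^ N = P.eval y := Iff.rfl

theorem additive_of_pow_eq_eval {f : AddMonoid.End K} {N : ℕ} {P : K[X]}
    (h : ∀ y, f y ^ p ^ N = P.eval y) (x y : K) : P.eval (x + y) = P.eval x + P.eval y := by
  rw [← h, ← h, ← h, map_add, add_pow_char_pow]

theorem surjective_of_ne_zero [IsAlgClosed K] {f : AddMonoid.End K}
    (hf : f ∈ frobeniusPolynomialRing K p) (h0 : f ≠ 0) : Function.Surjective f := by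
  obtain ⟨N, P, h⟩ := hf
  have hp : p ^ N ≠ 0 := pow_ne_zero _ (Fact.out : p.Prime).ne_zero
  intro z
  have hdeg : (P - C (z ^ p ^ N)).degree ≠ 0 := by
    intro hd
    apply h0
    have hP : P = C (P.coeff 0) := by
      have h1 := natDegree_eq_of_degree_eq_some hd
      rw [natDegree_sub_C] at h1
      exact eq_C_of_natDegree_eq_zero h1
    have hc : P.coeff 0 = 0 := by
      rw [coeff_zero_eq_eval_zero, ← h, map_zero, zero_pow hp]
    ext y
    have := h y
    rw [hP, hc, C_0, eval_zero] at this
    exact pow_eq_zero_iff hp |>.1 this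
  obtain ⟨y, hy⟩ := IsAlgClosed.exists_root _ hdeg
  refine ⟨y, iterateFrobenius_inj K p N ?_⟩
  rw [iterateFrobenius_def, iterateFrobenius_def, h]
  simpa [sub_eq_zero] using hy

instance [IsAlgClosed K] : IsDomain (frobeniusPolynomialRing K p) := by
  have : Nontrivial (frobeniusPolynomialRing K p) := ⟨0, 1, fun h => zero_ne_one (α := K) <|
    congrArg (fun a : frobeniusPolynomialRing K p => (a : AddMonoid.End K) 1) h⟩
  have : NoZeroDivisors (frobeniusPolynomialRing K p) := by
    refine ⟨fun {f g} hfg => ?_⟩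
    by_contra! h
    obtain ⟨hf, hg⟩ := h
    apply hf
    ext z
    obtain ⟨y, rfl⟩ := surjective_of_ne_zero g.2 (fun e => hg (Subtype.ext e)) z
    exact congrArg (fun a : frobeniusPolynomialRing K p => (a : AddMonoid.End K) y) hfg
  exact NoZeroDivisors.to_isDomain _

/-- The Frobenius automorphism of a perfect field, as a unit of `frobeniusPolynomialRing K p`. -/
noncomputable def frobeniusUnit (K : Type*) [Field K] (p : ℕ) [Fact p.Prime] [CharP K p]
    [PerfectRing K p] : (frobeniusPolynomialRing K p)ˣ where
  val := ⟨(frobenius K p).toAddMonoidHom, 0, X ^ p, fun y => by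
    rw [pow_zero, pow_one, eval_pow, eval_X]
    rfl⟩
  inv := ⟨(frobeniusEquiv K p).symm.toRingHom.toAddMonoidHom, 1, X, fun y => by
    rw [pow_one, eval_X]
    exact frobeniusEquiv_symm_pow_p K p y⟩
  val_inv := Subtype.ext <| AddMonoidHom.ext fun y => frobenius_apply_frobeniusEquiv_symm K p y
  inv_val := Subtype.ext <| AddMonoidHom.ext fun y => frobeniusEquiv_symm_apply_frobenius K p y

theorem frobeniusUnit_pow_apply [PerfectRing K p] (N : ℕ) (y : K) :
    ((frobeniusUnit K p ^ N : (frobeniusPolynomialRing K p)ˣ) : AddMonoid.End K) y = y ^ p ^ N := by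
  induction N generalizing y with
  | zero => simp
  | succ N ih =>
    have h : ((frobeniusUnit K p : frobeniusPolynomialRing K p) : AddMonoid.End K) y = y ^ p := rfl
    rw [pow_succ, Units.val_mul, Subring.coe_mul, AddMonoid.End.coe_mul, Function.comp_apply, h,
      ih, pow_succ', pow_mul]

/-- Solving `x = s * b + c * s` when `s` is a separable polynomial map. On the kernel of `s`, which
is finite, the equation prescribes `s ∘ b`; since `s` is surjective, an additive `b` on the kernel
exists, and it extends to an additive polynomial. Then `x - s * b` factors through `s`. -/
theorem exists_eq_of_separable [IsAlgClosed K] [Algebra (ZMod p) K]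
    {x s : AddMonoid.End K} (hx : x ∈ frobeniusPolynomialRing K p) {S : K[X]} (hsep : S.Separable)
    (hs : ∀ y, s y = S.eval y) :
    ∃ b ∈ frobeniusPolynomialRing K p, ∃ c ∈ frobeniusPolynomialRing K p, x = s * b + c * s := by
  have : Infinite K := IsAlgClosed.instInfinite
  have hSadd : ∀ x y, S.eval (x + y) = S.eval x + S.eval y := fun x y => by
    rw [← hs, ← hs, ← hs, map_add]
  have hs_mem : s ∈ frobeniusPolynomialRing K p := ⟨0, S, by simpa using hs⟩
  have hs0 : s ≠ 0 := by
    rintro rfl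
    exact hsep.ne_zero (Polynomial.funext fun y => by simp [← hs])
  have hsurj := surjective_of_ne_zero hs_mem hs0
  let sl : K →ₗ[ZMod p] K := AddMonoidHom.toZModLinearMap p s
  let xl : K →ₗ[ZMod p] K := AddMonoidHom.toZModLinearMap p x
  let V : Submodule (ZMod p) K := LinearMap.ker sl
  have hV : ∀ v, v ∈ V ↔ s v = 0 := fun v => LinearMap.mem_ker
  have hfin : Finite V.toAddSubgroup := by
    refine Set.Finite.subset (S.rootSet_finite K) fun v hv => ?_
    rw [mem_rootSet]
    refine ⟨hsep.ne_zero, ?_⟩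
    rw [coe_aeval_eq_eval, ← hs]
    exact (hV v).1 hv
  obtain ⟨g, hg⟩ := Module.projective_lifting_property sl (xl.comp V.subtype) hsurj
  obtain ⟨B, hBadd, hBg⟩ := exists_additive_interpolation V.toAddSubgroup
    (g.toAddMonoidHom : V.toAddSubgroup →+ K)
  let b : AddMonoid.End K := AddMonoidHom.mk' (fun y => B.eval y) hBadd
  have hb : b ∈ frobeniusPolynomialRing K p := ⟨0, B, fun y => pow_one _⟩
  have hker : ∀ v, s v = 0 → (x - s * b) v = 0 := by
    intro v hv
    have h1 : s (g ⟨v, (hV v).2 hv⟩) = x v := LinearMap.congr_fun hg ⟨v, (hV v).2 hv⟩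
    have h2 : b v = g ⟨v, (hV v).2 hv⟩ := hBg ⟨v, (hV v).2 hv⟩
    change x v - s (b v) = 0
    rw [h2, h1, sub_self]
  obtain ⟨N, Q, hQ⟩ := sub_mem hx (mul_mem hs_mem hb)
  obtain ⟨C, hC⟩ := exists_eq_comp_of_invariant hSadd hsep le_rfl (Q := Q) fun v hv y => by
    rw [← hQ, ← hQ, map_add, hker v ((hs v).trans hv), add_zero]
  let c : AddMonoid.End K := AddMonoidHom.liftOfRightInverse s _
    (Function.rightInverse_surjInv hsurj) ⟨x - s * b, fun v hv => hker v hv⟩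
  have hc : ∀ y, c (s y) = (x - s * b) y := fun y =>
    AddMonoidHom.liftOfRightInverse_comp_apply s _ (Function.rightInverse_surjInv hsurj)
      ⟨x - s * b, fun v hv => hker v hv⟩ y
  refine ⟨b, hb, c, ⟨N, C, fun z => ?_⟩, ?_⟩
  · obtain ⟨y, rfl⟩ := hsurj z
    rw [hc, hQ, hC, eval_comp, hs]
  · ext y
    change x y = s (b y) + c (s y)
    rw [hc]
    exact (add_sub_cancel _ _).symm

theorem isFadelian [IsAlgClosed K] [Algebra (ZMod p) K] :
    IsFadelian (frobeniusPolynomialRing K p) := by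
  refine ⟨inferInstance, fun x a ha => ?_⟩
  obtain ⟨N, P, hP⟩ := mem_iff.1 a.2
  have hP0 : P ≠ 0 := by
    rintro rfl
    apply ha
    ext y
    simpa [(Fact.out : p.Prime).ne_zero] using hP y
  obtain ⟨M, S, hsep, hSadd, hPS⟩ := exists_separable_pow (p := p) le_rfl hP0
    (additive_of_pow_eq_eval hP)
  let s : frobeniusPolynomialRing K p :=
    ⟨AddMonoidHom.mk' (fun y => S.eval y) hSadd, 0, S, fun y => pow_one _⟩
  -- `a` is a unit times the separable polynomial map `s`
  let u : (frobeniusPolynomialRing K p)ˣ := (frobeniusUnit K p ^ N)⁻¹ * frobeniusUnit K p ^ M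
  have hu : a = u * s := by
    rw [Units.val_mul, mul_assoc, Units.eq_inv_mul_iff_mul_eq]
    ext y
    rw [Subring.coe_mul, Subring.coe_mul, AddMonoid.End.coe_mul, AddMonoid.End.coe_mul,
      Function.comp_apply, Function.comp_apply, frobeniusUnit_pow_apply, frobeniusUnit_pow_apply,
      hP, hPS]
    rfl
  obtain ⟨b, hb, c, hc, h⟩ := exists_eq_of_separable (p := p) (s := s)
    (↑u⁻¹ * x : frobeniusPolynomialRing K p).2 hsep fun y => rfl
  have h' : ↑u⁻¹ * x = s * ⟨b, hb⟩ + ⟨c, hc⟩ * s := Subtype.ext h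
  refine ⟨⟨b, hb⟩, u * ⟨c, hc⟩ * ↑u⁻¹, ?_⟩
  rw [Units.inv_mul_eq_iff_eq_mul] at h'
  rw [h', hu, mul_add]
  simp only [mul_assoc, Units.inv_mul_cancel_left]

/-- `F - 1` is nonzero and has `1` in its kernel. -/
theorem exists_ne_zero_not_isUnit [IsAlgClosed K] :
    ∃ t : frobeniusPolynomialRing K p, t ≠ 0 ∧ ¬ IsUnit t := by
  have : Infinite K := IsAlgClosed.instInfinite
  have hp : p.Prime := Fact.out
  have happ : ∀ y : K, ((frobeniusUnit K p - 1 : frobeniusPolynomialRing K p) :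
      AddMonoid.End K) y = y ^ p - y := fun y => rfl
  refine ⟨frobeniusUnit K p - 1, fun h => ?_, fun h => ?_⟩
  · have h0 : (X ^ p - X : K[X]) = 0 := Polynomial.funext fun y => by
      have := happ y
      rw [h] at this
      simpa using this.symm
    exact FiniteField.X_pow_card_sub_X_ne_zero K hp.one_lt h0
  · obtain ⟨u, hu⟩ := h.exists_left_inv
    have := congrArg (fun f : frobeniusPolynomialRing K p => (f : AddMonoid.End K) 1) hu
    simp only [Subring.coe_mul, AddMonoid.End.coe_mul, Function.comp_apply, happ] at this
    simp at this

end frobeniusPolynomialRing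

/-! ### Strict chains of one-sided ideals -/

/-- The right ideals generated by `d 0, …, d (n - 1)` increase strictly with `n`. -/
def IsRightStrictChain {R : Type*} [Ring R] (d : ℕ → R) : Prop :=
  ∀ (n : ℕ) (y : ℕ → R), d n ≠ ∑ i ∈ Finset.range n, d i * y i

/-- The left ideals generated by `d 0, …, d (n - 1)` increase strictly with `n`. -/
def IsLeftStrictChain {R : Type*} [Ring R] (d : ℕ → R) : Prop :=
  ∀ (n : ℕ) (y : ℕ → R), d n ≠ ∑ i ∈ Finset.range n, y i * d i

theorem not_isNoetherian_of_strict {A M : Type*} [Ring A] [AddCommGroup M] [Module A M]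
    {d : ℕ → M} (hd : ∀ (n : ℕ) (y : ℕ → A), d n ≠ ∑ i ∈ Finset.range n, y i • d i) :
    ¬ IsNoetherian A M := by
  classical
  rw [← monotone_stabilizes_iff_noetherian]
  push Not
  refine ⟨⟨fun n => Submodule.span A (d '' (Finset.range n : Set ℕ)), fun m n hmn =>
    Submodule.span_mono (Set.image_mono (by simpa using hmn))⟩, fun n => ⟨n + 1, by simp, ?_⟩⟩
  intro h
  have hmem : d n ∈ Submodule.span A (d '' (Finset.range n : Set ℕ)) := by
    change Submodule.span A (d '' (Finset.range n : Set ℕ)) =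
      Submodule.span A (d '' (Finset.range (n + 1) : Set ℕ)) at h
    rw [h]
    exact Submodule.subset_span ⟨n, by simp, rfl⟩
  obtain ⟨y, hy⟩ := (Submodule.mem_span_image_finset_iff_exists_fun A).1 hmem
  refine hd n (fun i => if h : i ∈ Finset.range n then y ⟨i, h⟩ else 0) ?_
  rw [← hy, ← Finset.sum_coe_sort (Finset.range n)]
  simp

theorem IsLeftStrictChain.not_isLeftNoetherian {R : Type*} [Ring R] {d : ℕ → R}
    (hd : IsLeftStrictChain d) : ¬ IsLeftNoetherian R :=
  not_isNoetherian_of_strict (A := R) hd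

theorem IsRightStrictChain.not_isRightNoetherian {R : Type*} [Ring R] {d : ℕ → R}
    (hd : IsRightStrictChain d) : ¬ IsRightNoetherian R :=
  not_isNoetherian_of_strict (A := Rᵐᵒᵖ) fun n y => hd n fun i => (y i).unop

/-! ### Ultrapowers -/

namespace Filter.Germ

variable {T : Type*} [Ring T]

theorem isDomain [IsDomain T] {ι : Type*} (l : Ultrafilter ι) :
    IsDomain (Germ (l : Filter ι) T) := by
  have : NoZeroDivisors (Germ (l : Filter ι) T) := by
    refine ⟨fun {f g} => Filter.Germ.inductionOn₂ f g fun f g h => ?_⟩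
    have h' : ∀ᶠ i in (l : Filter ι), f i * g i = 0 := Filter.Germ.coe_eq.1 h
    simp only [mul_eq_zero] at h'
    rcases Ultrafilter.eventually_or.1 h' with h | h
    · exact Or.inl (Filter.Germ.coe_eq.2 h)
    · exact Or.inr (Filter.Germ.coe_eq.2 h)
  exact NoZeroDivisors.to_isDomain _

theorem isFadelian (hT : IsFadelian T) {ι : Type*} (l : Ultrafilter ι) :
    IsFadelian (Germ (l : Filter ι) T) := by
  have := hT.nontrivial
  refine ⟨inferInstance, fun x a => Filter.Germ.inductionOn₂ x a fun x a ha => ?_⟩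
  have ha' : ∀ᶠ i in (l : Filter ι), a i ≠ 0 :=
    Ultrafilter.eventually_not.2 fun h => ha (Filter.Germ.coe_eq.2 h)
  have : ∀ i, ∃ bc : T × T, a i ≠ 0 → x i = a i * bc.1 + bc.2 * a i := fun i => by
    by_cases hi : a i = 0
    · exact ⟨0, fun h => (h hi).elim⟩
    · obtain ⟨b, c, h⟩ := hT.exists_eq (x i) (a i) hi
      exact ⟨(b, c), fun _ => h⟩
  choose bc hbc using this
  exact ⟨((fun i => (bc i).1 : ι → T) : Germ (l : Filter ι) T),
    ((fun i => (bc i).2 : ι → T) : Germ (l : Filter ι) T),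
    Filter.Germ.coe_eq.2 (ha'.mono hbc)⟩

end Filter.Germ

/-- If `d n = d (n + 1) * t = t * d (n + 1)` with `t` not a unit, then the one-sided ideals
generated by the `d n` increase strictly. -/
theorem isStrictChain_of_mul_eq {S : Type*} [Ring S] [IsDomain S] {t : S} (ht : ¬ IsUnit t)
    {d : ℕ → S} (h0 : ∀ n, d n ≠ 0) (hr : ∀ n, d n = d (n + 1) * t)
    (hl : ∀ n, d n = t * d (n + 1)) : IsRightStrictChain d ∧ IsLeftStrictChain d := by
  have ht0 : t ≠ 0 := by
    rintro rfl
    exact h0 0 (by rw [hr, mul_zero])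
  have hR : ∀ n k, d n = d (n + k) * t ^ k := fun n k => by
    induction k with
    | zero => simp
    | succ k ih => rw [ih, hr (n + k), pow_succ', ← mul_assoc, add_assoc]
  have hL : ∀ n k, d n = t ^ k * d (n + k) := fun n k => by
    induction k with
    | zero => simp
    | succ k ih => rw [ih, hl (n + k), pow_succ, mul_assoc, add_assoc]
  constructor
  · intro n y h
    have h1 : d n * 1 = d n * (t * ∑ i ∈ Finset.range n, t ^ (n - i - 1) * y i) := by
      rw [mul_one, Finset.mul_sum, Finset.mul_sum]
      refine h.trans (Finset.sum_congr rfl fun i hi => ?_)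
      have hi := Finset.mem_range.1 hi
      rw [hR i (n - i), Nat.add_sub_of_le hi.le, ← mul_assoc t, ← pow_succ',
        Nat.sub_add_cancel (by omega), mul_assoc]
    have h2 := (mul_left_cancel₀ (h0 n) h1).symm
    exact ht (isUnit_iff_exists_inv.2 ⟨_, h2⟩)
  · intro n y h
    have h1 : 1 * d n = ((∑ i ∈ Finset.range n, y i * t ^ (n - i - 1)) * t) * d n := by
      rw [one_mul, Finset.sum_mul, Finset.sum_mul]
      refine h.trans (Finset.sum_congr rfl fun i hi => ?_)
      have hi := Finset.mem_range.1 hi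
      rw [hL i (n - i), Nat.add_sub_of_le hi.le, mul_assoc (y i), ← pow_succ,
        Nat.sub_add_cancel (by omega), mul_assoc]
    have h2 := (mul_right_cancel₀ (h0 n) h1).symm
    exact ht (isUnit_iff_exists_inv'.2 ⟨_, h2⟩)

/-- An ultrapower of a domain `T` with a nonunit `t ≠ 0` contains strict chains on both sides: take
`d n` to be the class of `k ↦ t ^ (k - n)`. -/
theorem exists_strictChain_germ {T : Type*} [Ring T] [IsDomain T] {t : T} (h0 : t ≠ 0)
    (ht : ¬ IsUnit t) :
    ∃ d : ℕ → Filter.Germ (Filter.hyperfilter ℕ : Filter ℕ) T,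
      IsRightStrictChain d ∧ IsLeftStrictChain d := by
  have := Filter.Germ.isDomain (T := T) (Filter.hyperfilter ℕ)
  have hev : ∀ n, ∀ᶠ k in (Filter.hyperfilter ℕ : Filter ℕ), n + 1 ≤ k := fun n =>
    (Filter.eventually_ge_atTop (n + 1)).filter_mono Nat.hyperfilter_le_atTop
  refine ⟨fun n => ((fun k => t ^ (k - n) : ℕ → T) : Filter.Germ _ T),
    isStrictChain_of_mul_eq (t := ((fun _ => t : ℕ → T) : Filter.Germ _ T)) ?_ ?_ ?_ ?_⟩
  · intro hu
    obtain ⟨s, hs⟩ := isUnit_iff_exists_inv.1 hu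
    induction s using Filter.Germ.inductionOn with | _ s => ?_
    have h' : ∀ᶠ i in (Filter.hyperfilter ℕ : Filter ℕ), t * s i = 1 := Filter.Germ.coe_eq.1 hs
    obtain ⟨i, hi⟩ := h'.exists
    exact ht (isUnit_iff_exists_inv.2 ⟨_, hi⟩)
  · intro n h
    have h' : ∀ᶠ k in (Filter.hyperfilter ℕ : Filter ℕ), t ^ (k - n) = 0 :=
      Filter.Germ.coe_eq.1 h
    obtain ⟨k, hk⟩ := h'.exists
    exact pow_ne_zero _ h0 hk
  · refine fun n => Filter.Germ.coe_eq.2 ((hev n).mono fun k hk => ?_)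
    change t ^ (k - n) = t ^ (k - (n + 1)) * t
    rw [← pow_succ]
    congr 1
    omega
  · refine fun n => Filter.Germ.coe_eq.2 ((hev n).mono fun k hk => ?_)
    change t ^ (k - n) = t * t ^ (k - (n + 1))
    rw [← pow_succ']
    congr 1
    omega

/-! ### Passing to a countable subring -/

theorem Set.Countable.exists_countable_superset_closed {S ι : Type*} [Countable ι]
    (op : ι → S → S → S) {s : Set S} (hs : s.Countable) :
    ∃ u : Set S, s ⊆ u ∧ u.Countable ∧ ∀ i, ∀ x ∈ u, ∀ y ∈ u, op i x y ∈ u := by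
  let F : Set S → Set S := fun u => u ∪ ⋃ i, Set.image2 (op i) u u
  have hmono : Monotone fun n => F^[n] s := monotone_nat_of_le_succ fun n => by
    rw [Function.iterate_succ_apply']
    exact Set.subset_union_left
  refine ⟨⋃ n, F^[n] s, Set.subset_iUnion (fun n => F^[n] s) 0,
    Set.countable_iUnion fun n => ?_, ?_⟩
  · induction n with
    | zero => exact hs
    | succ n ih =>
      rw [Function.iterate_succ_apply']
      exact ih.union (Set.countable_iUnion fun i => ih.image2 ih _)
  · intro i x hx y hy
    obtain ⟨m, hm⟩ := Set.mem_iUnion.1 hx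
    obtain ⟨n, hn⟩ := Set.mem_iUnion.1 hy
    refine Set.mem_iUnion.2 ⟨max m n + 1, ?_⟩
    rw [Function.iterate_succ_apply']
    exact Or.inr <| Set.mem_iUnion.2 ⟨i, Set.mem_image2_of_mem
      (hmono (le_max_left m n) hm) (hmono (le_max_right m n) hn)⟩

/-- A countable subset of a fadelian ring lies in a countable fadelian subring. -/
theorem IsFadelian.exists_countable_subring {S : Type*} [Ring S] (hS : IsFadelian S) {s : Set S}
    (hs : s.Countable) : ∃ R : Subring S, s ⊆ R ∧ Countable R ∧ IsFadelian R := by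
  have := hS.nontrivial
  have hbc : ∀ x a : S, ∃ b c : S, a ≠ 0 → x = a * b + c * a := fun x a => by
    by_cases ha : a = 0
    · exact ⟨0, 0, fun h => (h ha).elim⟩
    · obtain ⟨b, c, h⟩ := hS.exists_eq x a ha
      exact ⟨b, c, fun _ => h⟩
  choose b c hbc using hbc
  obtain ⟨u, hsu, hu, hop⟩ := (hs.insert 1).exists_countable_superset_closed
    ![fun x y => x - y, fun x y => x * y, b, c]
  have h1 : (1 : S) ∈ u := hsu (Set.mem_insert _ _)
  have hsub : ∀ {x y}, x ∈ u → y ∈ u → x - y ∈ u := fun hx hy => hop 0 _ hx _ hy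
  have h0 : (0 : S) ∈ u := by simpa using hsub h1 h1
  have hneg : ∀ {x}, x ∈ u → -x ∈ u := fun hx => by simpa using hsub h0 hx
  let R : Subring S :=
    { carrier := u
      one_mem' := h1
      zero_mem' := h0
      neg_mem' := hneg
      add_mem' := fun hx hy => by simpa using hsub hx (hneg hy)
      mul_mem' := fun hx hy => hop 1 _ hx _ hy }
  refine ⟨R, (Set.subset_insert _ _).trans hsu, hu, inferInstance, fun x a ha => ?_⟩
  exact ⟨⟨b x a, hop 2 _ x.2 _ a.2⟩, ⟨c x a, hop 3 _ x.2 _ a.2⟩,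
    Subtype.ext (hbc x a fun h => ha (Subtype.ext h))⟩

/-! ### Laurent series -/

section LaurentSeries

variable {R : Type*} [Ring R]

theorem HahnSeries.commute_single_one (n : ℤ) (f : LaurentSeries R) :
    Commute (HahnSeries.single n (1 : R)) f := by
  ext k
  rw [HahnSeries.coeff_single_mul, HahnSeries.coeff_mul_single, one_mul, mul_one]

/-- `x = a * b + c * a` can be solved coefficient by coefficient when the constant coefficient of
`a` is nonzero. -/
theorem IsFadelian.exists_powerSeries_eq (hR : IsFadelian R) (x a : PowerSeries R)
    (ha : PowerSeries.coeff 0 a ≠ 0) : ∃ b c : PowerSeries R, x = a * b + c * a := by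
  choose β γ h using fun y => hR.exists_eq y _ ha
  -- `r n` is the part of the `n`-th coefficient of `x` that is not yet accounted for by the
  -- coefficients of `b` and `c` of index less than `n`
  have hr : ∃ r : ℕ → R, ∀ n, r n = PowerSeries.coeff n x - ∑ j ∈ Finset.range n,
      (PowerSeries.coeff (n - j) a * β (r j) + γ (r j) * PowerSeries.coeff (n - j) a) := by
    let r : ℕ → R := WellFounded.fix (C := fun _ => R) Nat.lt_wfRel.wf fun n r =>
      PowerSeries.coeff n x - ∑ j : Fin n,
        (PowerSeries.coeff (n - j) a * β (r j j.2) + γ (r j j.2) * PowerSeries.coeff (n - j) a)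
    refine ⟨r, fun n => ?_⟩
    rw [Finset.sum_range]
    exact WellFounded.fix_eq _ _ n
  obtain ⟨r, hr⟩ := hr
  refine ⟨PowerSeries.mk fun n => β (r n), PowerSeries.mk fun n => γ (r n), ?_⟩
  ext n
  rw [map_add, PowerSeries.coeff_mul, PowerSeries.coeff_mul,
    ← Finset.Nat.sum_antidiagonal_swap, ← Finset.sum_add_distrib]
  · simp only [Prod.fst_swap, Prod.snd_swap, PowerSeries.coeff_mk]
    rw [Finset.Nat.sum_antidiagonal_eq_sum_range_succ_mk, Finset.sum_range_succ, Nat.sub_self,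
      ← h, hr n]
    simp

open HahnSeries in
theorem IsFadelian.laurentSeries (hR : IsFadelian R) : IsFadelian (LaurentSeries R) := by
  have := hR.nontrivial
  refine ⟨inferInstance, fun x a ha => ?_⟩
  have ha0 : PowerSeries.coeff 0 a.powerSeriesPart ≠ 0 := by
    simpa using coeff_order_eq_zero.not.2 ha
  obtain ⟨b, c, h⟩ := hR.exists_powerSeries_eq x.powerSeriesPart a.powerSeriesPart ha0
  have hx := x.single_order_mul_powerSeriesPart
  have ha' := a.single_order_mul_powerSeriesPart
  rw [h, map_add, map_mul, map_mul] at hx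
  have hs : (single x.order (1 : R)) = single (x.order - a.order) 1 * single a.order 1 := by
    rw [single_mul_single, sub_add_cancel, one_mul]
  set A := ofPowerSeries ℤ R a.powerSeriesPart
  generalize x.order - a.order = k at hs
  generalize a.order = m at hs ha'
  refine ⟨single k 1 * ofPowerSeries ℤ R b, single k 1 * ofPowerSeries ℤ R c, ?_⟩
  rw [← hx, ← ha', hs, mul_add]
  congr 1
  · rw [(commute_single_one k (single m 1)).eq]
    simp only [mul_assoc]
    rw [(commute_single_one k A).left_comm]
  · simp only [mul_assoc]
    rw [(commute_single_one m (ofPowerSeries ℤ R c)).left_comm]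

/-- In a fadelian ring with a strict chain of right ideals `I n = d 0 R + ⋯ + d (n - 1) R`, a right
multiple of `d n` can be moved out of `I n` by a given nonzero element: otherwise
`1 = h * b + c * h` would give `d n = (d n * h) * b + (d n * c) * h ∈ I n`. -/
theorem IsRightStrictChain.exists_mul_mul_ne (hR : IsFadelian R) {d : ℕ → R}
    (hd : IsRightStrictChain d) (n : ℕ) {h : R} (hh : h ≠ 0) :
    ∃ w, ∀ y : ℕ → R, d n * w * h ≠ ∑ i ∈ Finset.range n, d i * y i := by
  by_contra! hcon
  obtain ⟨b, c, hbc⟩ := hR.exists_eq 1 h hh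
  obtain ⟨y, hy⟩ := hcon 1
  obtain ⟨z, hz⟩ := hcon c
  refine hd n (fun i => y i * b + z i) ?_
  simp only [mul_add, Finset.sum_add_distrib, ← mul_assoc]
  rw [← hz, ← Finset.sum_mul, ← hy, mul_one, mul_assoc, mul_assoc, ← mul_add, ← hbc, mul_one]

theorem IsLeftStrictChain.exists_mul_mul_ne (hR : IsFadelian R) {d : ℕ → R}
    (hd : IsLeftStrictChain d) (n : ℕ) {h : R} (hh : h ≠ 0) :
    ∃ w, ∀ y : ℕ → R, h * (w * d n) ≠ ∑ i ∈ Finset.range n, y i * d i := by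
  by_contra! hcon
  obtain ⟨b, c, hbc⟩ := hR.exists_eq 1 h hh
  obtain ⟨y, hy⟩ := hcon 1
  obtain ⟨z, hz⟩ := hcon b
  refine hd n (fun i => z i + c * y i) ?_
  simp only [add_mul, Finset.sum_add_distrib, mul_assoc]
  rw [← hz, ← Finset.mul_sum, ← hy, one_mul, ← mul_assoc, ← mul_assoc, ← add_mul, ← hbc, one_mul]

open HahnSeries in
/-- The right ideals generated by the constant `d 0` and by `f = ∑ d (n + 1) w n X ^ n` meet
trivially, where `w n` is chosen so that `d (n + 1) w n h ∉ d 0 R + ⋯ + d n R` for `h` the `n`-th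
element of `R` in a fixed enumeration, when it is nonzero: if
`f * g = d 0 * l` and `g` has leading coefficient `h`, then the coefficient of `f * g` that involves
`d (n + 1) w n h` gives a contradiction. -/
theorem IsRightStrictChain.not_isRightOre_laurentSeries [Countable R] (hR : IsFadelian R)
    {d : ℕ → R} (hd : IsRightStrictChain d) : ¬ IsRightOre (LaurentSeries R) := by
  have := hR.nontrivial
  obtain ⟨e, he⟩ := exists_surjective_nat R
  have hw : ∀ n, ∃ w, e n ≠ 0 → ∀ y : ℕ → R,
      d (n + 1) * w * e n ≠ ∑ i ∈ Finset.range (n + 1), d i * y i := fun n => by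
    by_cases hn : e n = 0
    · exact ⟨0, fun h => (h hn).elim⟩
    · obtain ⟨w, hw⟩ := hd.exists_mul_mul_ne hR (n + 1) hn
      exact ⟨w, fun _ => hw⟩
  choose w hw using hw
  have hd0 : d 0 ≠ 0 := by simpa using hd 0 0
  let f : PowerSeries R := PowerSeries.mk fun n => d (n + 1) * w n
  have key : ∀ g l : LaurentSeries R,
      ofPowerSeries ℤ R f * g = single 0 (d 0) * l → g = 0 := by
    intro g l hgl
    by_contra hg
    obtain ⟨n, hn⟩ := he g.leadingCoeff
    have hn0 : e n ≠ 0 := hn ▸ leadingCoeff_ne_zero.2 hg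
    -- compare coefficients of `X ^ n`, where `G` is `g` shifted to have constant coefficient `e n`
    let G := g.powerSeriesPart
    have hG : ofPowerSeries ℤ R (f * G) = single 0 (d 0) * (single (-g.order) 1 * l) := by
      rw [map_mul, LaurentSeries.ofPowerSeries_powerSeriesPart,
        ← (commute_single_one (-g.order) (ofPowerSeries ℤ R f)).left_comm, hgl,
        (commute_single_one (-g.order) (single 0 (d 0))).left_comm]
    have hc := congrArg (fun z : LaurentSeries R => z.coeff (n : ℤ)) hG
    simp only [ofPowerSeries_apply_coeff, coeff_single_zero_mul] at hc
    rw [PowerSeries.coeff_mul, Finset.Nat.sum_antidiagonal_eq_sum_range_succ_mk,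
      Finset.sum_range_succ, Nat.sub_self, ← eq_sub_iff_add_eq'] at hc
    have hG0 : PowerSeries.coeff 0 G = e n := by
      rw [hn, LaurentSeries.powerSeriesPart_coeff, Nat.cast_zero, add_zero, leadingCoeff_eq]
    simp only [hG0, f, PowerSeries.coeff_mk] at hc
    refine hw n hn0 (fun i => Nat.casesOn i ((single (-g.order) 1 * l).coeff (n : ℤ))
      fun i => -(w i * PowerSeries.coeff (n - i) G)) ?_
    rw [hc, Finset.sum_range_succ', add_comm, sub_eq_add_neg, ← Finset.sum_neg_distrib]
    simp only [mul_neg, mul_assoc]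
    rfl
  have hf0 : ofPowerSeries ℤ R f ≠ 0 := fun h => one_ne_zero (key 1 0 (by rw [h]; simp))
  intro hOre
  refine hOre (Submodule.span _ {ofPowerSeries ℤ R f}) (Submodule.span _ {single 0 (d 0)})
    (by simpa using hf0) (by simpa using hd0) ?_
  rw [eq_bot_iff]
  rintro z ⟨hz1, hz2⟩
  obtain ⟨g, rfl⟩ := Submodule.mem_span_singleton.1 hz1
  obtain ⟨l, hl⟩ := Submodule.mem_span_singleton.1 hz2
  have := key g.unop l.unop hl.symm
  rw [Submodule.mem_bot, ← MulOpposite.op_unop g, this, MulOpposite.op_zero, zero_smul]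

open HahnSeries in
/-- The mirror image of `IsRightStrictChain.not_isRightOre_laurentSeries`, with the left ideals
generated by `d 0` and by `∑ w n d (n + 1) X ^ n`. -/
theorem IsLeftStrictChain.not_isLeftOre_laurentSeries [Countable R] (hR : IsFadelian R)
    {d : ℕ → R} (hd : IsLeftStrictChain d) : ¬ IsLeftOre (LaurentSeries R) := by
  have := hR.nontrivial
  obtain ⟨e, he⟩ := exists_surjective_nat R
  have hw : ∀ n, ∃ w, e n ≠ 0 → ∀ y : ℕ → R,
      e n * (w * d (n + 1)) ≠ ∑ i ∈ Finset.range (n + 1), y i * d i := fun n => by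
    by_cases hn : e n = 0
    · exact ⟨0, fun h => (h hn).elim⟩
    · obtain ⟨w, hw⟩ := hd.exists_mul_mul_ne hR (n + 1) hn
      exact ⟨w, fun _ => hw⟩
  choose w hw using hw
  have hd0 : d 0 ≠ 0 := by simpa using hd 0 0
  let f : PowerSeries R := PowerSeries.mk fun n => w n * d (n + 1)
  have key : ∀ g l : LaurentSeries R,
      g * ofPowerSeries ℤ R f = l * single 0 (d 0) → g = 0 := by
    intro g l hgl
    by_contra hg
    obtain ⟨n, hn⟩ := he g.leadingCoeff
    have hn0 : e n ≠ 0 := hn ▸ leadingCoeff_ne_zero.2 hg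
    -- compare coefficients of `X ^ n`, where `G` is `g` shifted to have constant coefficient `e n`
    let G := g.powerSeriesPart
    have hG : ofPowerSeries ℤ R (G * f) = (single (-g.order) 1 * l) * single 0 (d 0) := by
      rw [map_mul, LaurentSeries.ofPowerSeries_powerSeriesPart, mul_assoc, hgl, mul_assoc]
    have hc := congrArg (fun z : LaurentSeries R => z.coeff (n : ℤ)) hG
    simp only [ofPowerSeries_apply_coeff, coeff_mul_single_zero] at hc
    rw [PowerSeries.coeff_mul, ← Finset.Nat.sum_antidiagonal_swap,
      Finset.Nat.sum_antidiagonal_eq_sum_range_succ_mk,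
      Finset.sum_range_succ, Nat.sub_self, ← eq_sub_iff_add_eq'] at hc
    have hG0 : PowerSeries.coeff 0 G = e n := by
      rw [hn, LaurentSeries.powerSeriesPart_coeff, Nat.cast_zero, add_zero, leadingCoeff_eq]
    simp only [Prod.swap, hG0, f, PowerSeries.coeff_mk] at hc
    refine hw n hn0 (fun i => Nat.casesOn i ((single (-g.order) 1 * l).coeff (n : ℤ))
      fun i => -(PowerSeries.coeff (n - i) G * w i)) ?_
    rw [hc, Finset.sum_range_succ', add_comm, sub_eq_add_neg, ← Finset.sum_neg_distrib]
    simp only [neg_mul, mul_assoc]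
    rfl
  have hf0 : ofPowerSeries ℤ R f ≠ 0 := fun h => one_ne_zero (key 1 0 (by rw [h]; simp))
  intro hOre
  refine hOre (Submodule.span _ {ofPowerSeries ℤ R f}) (Submodule.span _ {single 0 (d 0)})
    (by simpa using hf0) (by simpa using hd0) ?_
  rw [eq_bot_iff]
  rintro z ⟨hz1, hz2⟩
  obtain ⟨g, rfl⟩ := Submodule.mem_span_singleton.1 hz1
  obtain ⟨l, hl⟩ := Submodule.mem_span_singleton.1 hz2
  have := key g l hl.symm
  rw [Submodule.mem_bot, this, zero_smul]

end LaurentSeries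

theorem mainTheorem5 :
    ∃ (R : Type) (_ : Ring R),
      Countable R ∧ IsFadelian R ∧ ¬ IsLeftNoetherian R ∧ ¬ IsRightNoetherian R ∧
      IsDomain (LaurentSeries R) ∧ IsFadelian (LaurentSeries R) ∧
      ¬ IsRightOre (LaurentSeries R) ∧ ¬ IsLeftOre (LaurentSeries R) := by
  have : Fact (Nat.Prime 2) := ⟨Nat.prime_two⟩
  let K := AlgebraicClosure (ZMod 2)
  have : CharP K 2 := charP_of_injective_algebraMap (algebraMap (ZMod 2) K).injective 2
  obtain ⟨t, ht0, ht⟩ := frobeniusPolynomialRing.exists_ne_zero_not_isUnit (K := K) (p := 2)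
  obtain ⟨d, hdr, hdl⟩ := exists_strictChain_germ ht0 ht
  have := Filter.Germ.isDomain (T := frobeniusPolynomialRing K 2) (Filter.hyperfilter ℕ)
  obtain ⟨R, hdR, hcount, hR⟩ := (Filter.Germ.isFadelian
    (frobeniusPolynomialRing.isFadelian (K := K) (p := 2))
    (Filter.hyperfilter ℕ)).exists_countable_subring (Set.countable_range d)
  let d' : ℕ → R := fun n => ⟨d n, hdR ⟨n, rfl⟩⟩
  have hr : IsRightStrictChain d' := fun n y h => hdr n (fun i => y i) <| by
    simpa [d'] using congrArg (Subtype.val) h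
  have hl : IsLeftStrictChain d' := fun n y h => hdl n (fun i => y i) <| by
    simpa [d'] using congrArg (Subtype.val) h
  exact ⟨R, inferInstance, hcount, hR, hl.not_isLeftNoetherian, hr.not_isRightNoetherian,
    inferInstance, hR.laurentSeries, hr.not_isRightOre_laurentSeries hR,
    hl.not_isLeftOre_laurentSeries hR⟩
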